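/- Let $A,B$ be real symmetric positive definite $m\times m$ matrices with $A-B$ invertible, and let $0<q<1$. For matrices $U,V$ with $V$ invertible write $\frac{U}{V}=V^{-1}U$. Given matrices $a_0,a_1,\dots$ and $b_1,b_2,\dots$, the convergents of the continued fraction $\left[a_0;\frac{b_1}{a_1},\frac{b_2}{a_2},\dots\right]$ are $\frac{p_n}{q_n}=q_n^{-1}p_n$, where $p_{-1}=I$, $p_0=a_0$, $q_{-1}=0$, $q_0=I$ and $p_n=a_np_{n-1}+b_np_{n-2}$, $q_n=a_nq_{n-1}+b_nq_{n-2}$ for $n\ge1$. We write $T=\left[a_0;\frac{b_1}{a_1},\frac{b_2}{a_2},\dots\right]$ if every $q_n$ is invertible and $\lim_{n\to\infty}q_n^{-1}p_n=T$. Put $X=A^{-1/2}BA^{-1/2}$ and $\Phi=\varphi(X)$ with $\varphi(X)=\frac{I-X}{I+X}$, and let $$S_q(A|B)=A^{1/2}X^q\ln(X)A^{1/2}$$ be the generalized operator entropy. Let $A_0'=I$, $\widetilde A_0'=0$, $$A_1'=\frac{-I-q\Phi}{2q\Phi},\qquad A'_{2k}=\frac{-2q\prod_{j=1}^{k-1}\left(q^2-(2j)^2\right)}{\prod_{j=1}^{k}\left(q^2-(2j-1)^2\right)}(4k-1)\,\Phi^{-1},\qquad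 A'_{2k+1}=\frac{-\prod_{j=1}^{k}\left(q^2-(2j-1)^2\right)}{2q\prod_{j=1}^{k}\left(q^2-(2j)^2\right)}(4k+1)\,\Phi^{-1}\quad(k\ge1),$$ $$\widetilde A_1'=(-2\Phi)^{-1},\qquad \widetilde A'_{2k}=\frac{2\left(2\cdot4\cdots(2k-2)\right)^2}{\left(1\cdot3\cdots(2k-1)\right)^2}(4k-1)\,\Phi^{-1},\qquad \widetilde A'_{2k+1}=\frac{-\left(1\cdot3\cdots(2k-1)\right)^2}{2\left(2\cdot4\cdots(2k)\right)^2}(4k+1)\,\Phi^{-1}\quad(k\ge1).$$ Let $P_n,Q_n$ (resp. $\widetilde P_n,\widetilde Q_n$) be the numerators and denominators, given by the recurrence above, of the convergents of $\left[A_0';\frac{I}{A_1'},\frac{I}{A_2'},\dots\right]$ (resp. $\left[\widetilde A_0';\frac{I}{\widetilde A_1'},\frac{I}{\widetilde A_2'},\dots\right]$). For $n\ge2$ put $$G_n=Q_nP_{n-1}+\widetilde Q_{n-1}\widetilde P_n,\qquad E_n=Q_n\widetilde Q_n\left(Q_{n-2}P_{n-1}+\widetilde Q_{n-1}\widetilde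 P_{n-2}\right),\qquad F_n=Q_{n-2}\widetilde Q_{n-2}G_n .$$ Then $\Phi=A^{1/2}\left(\frac{A-B}{A+B}\right)A^{-1/2}$, $$X^q=\left[I;\frac{I}{A_k'}\right]_{k=1}^{+\infty},\qquad \ln X=\left[0;\frac{I}{\widetilde A_k'}\right]_{k=1}^{+\infty},$$ and, provided that $G_n$ is invertible for all $n\ge2$, we have $$S_q(A|B)=\left[0;\ \frac{(A'_1+I)A^{1/2}}{A'_1\widetilde A'_1A^{-1/2}},\ \frac{\left((A'_1A'_2+I)(A'_1+I)+\widetilde A'_1\widetilde A'_2\right)A^{-1/2}}{(A'_1A'_2+A'_2+I)\widetilde A'_2},\ \frac{(A'_1\widetilde A'_1)^{-1}E_2F_3}{E_3-F_3},\ \frac{E_{n-1}F_n}{E_n-F_n}\right]_{n=4}^{+\infty}.$$ -/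

import Mathlib

open Matrix Filter Topology

namespace OperatorEntropy

noncomputable section

variable {m : ℕ}

/-! Continued fractions `[a 0; b 1 / a 1, b 2 / a 2, …]` with square real matrices as entries, where
`b / a` stands for `a⁻¹ * b`. The entry `b 0` plays no role. -/

/-- Numerators `Pₙ` of the convergents: `P₋₁ = I`, `P₀ = a₀`, `Pₙ = aₙ Pₙ₋₁ + bₙ Pₙ₋₂`. -/
def cfNum (a b : ℕ → Matrix (Fin m) (Fin m) ℝ) : ℕ → Matrix (Fin m) (Fin m) ℝ
  | 0 => a 0
  | 1 => a 1 * a 0 + b 1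
  | n + 2 => a (n + 2) * cfNum a b (n + 1) + b (n + 2) * cfNum a b n

/-- Denominators `Qₙ` of the convergents: `Q₋₁ = 0`, `Q₀ = I`, `Qₙ = aₙ Qₙ₋₁ + bₙ Qₙ₋₂`. -/
def cfDen (a b : ℕ → Matrix (Fin m) (Fin m) ℝ) : ℕ → Matrix (Fin m) (Fin m) ℝ
  | 0 => 1
  | 1 => a 1
  | n + 2 => a (n + 2) * cfDen a b (n + 1) + b (n + 2) * cfDen a b n

/-- `T = [a 0; b 1 / a 1, b 2 / a 2, …]`: all the convergents `Pₙ / Qₙ = Qₙ⁻¹ * Pₙ` are defined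
(no `Qₙ` is singular), and they converge to `T`. -/
def IsContFrac (a b : ℕ → Matrix (Fin m) (Fin m) ℝ) (T : Matrix (Fin m) (Fin m) ℝ) : Prop :=
  (∀ n, IsUnit (cfDen a b n)) ∧
    Tendsto (fun n => (cfDen a b n)⁻¹ * cfNum a b n) atTop (𝓝 T)

/-! Functions of matrices, by the functional calculus of symmetric matrices. -/

/-- The real power `A ^ s` of a positive definite matrix. -/
def matPow (A : Matrix (Fin m) (Fin m) ℝ) (s : ℝ) : Matrix (Fin m) (Fin m) ℝ :=
  cfc (fun x : ℝ => x ^ s) A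

/-- The logarithm `ln A` of a positive definite matrix. -/
def matLog (A : Matrix (Fin m) (Fin m) ℝ) : Matrix (Fin m) (Fin m) ℝ :=
  cfc Real.log A

/-- `φ(X) = (I - X) / (I + X)`. -/
def phi (X : Matrix (Fin m) (Fin m) ℝ) : Matrix (Fin m) (Fin m) ℝ :=
  (1 + X)⁻¹ * (1 - X)

/-- `A^{-1/2} B A^{-1/2}`. -/
def relMat (A B : Matrix (Fin m) (Fin m) ℝ) : Matrix (Fin m) (Fin m) ℝ :=
  matPow A (-(1 / 2)) * B * matPow A (-(1 / 2))

/-- The generalized operator entropy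
`S_q(A|B) = A^{1/2} (A^{-1/2} B A^{-1/2})^q ln (A^{-1/2} B A^{-1/2}) A^{1/2}`. -/
def entropy (q : ℝ) (A B : Matrix (Fin m) (Fin m) ℝ) : Matrix (Fin m) (Fin m) ℝ :=
  matPow A (1 / 2) * matPow (relMat A B) q * matLog (relMat A B) * matPow A (1 / 2)

/-! In all that follows, `Φ` stands for the matrix `φ(X)`. -/

/-- The partial denominators `A₀ = I, A₁, A₂, …` of the simple continued fraction of `X ^ q`. -/
def powCoeff (q : ℝ) (Φ : Matrix (Fin m) (Fin m) ℝ) (n : ℕ) : Matrix (Fin m) (Fin m) ℝ :=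
  if n = 0 then 1
  else if n = 1 then ((2 * q) • Φ)⁻¹ * (-1 - q • Φ)
  else if Even n then
    let k := n / 2
    (-2 * q * (∏ j ∈ Finset.Ico 1 k, (q ^ 2 - (2 * (j : ℝ)) ^ 2)) /
      (∏ j ∈ Finset.Icc 1 k, (q ^ 2 - (2 * (j : ℝ) - 1) ^ 2)) * (4 * (k : ℝ) - 1)) • Φ⁻¹
  else
    let k := n / 2
    (-(∏ j ∈ Finset.Icc 1 k, (q ^ 2 - (2 * (j : ℝ) - 1) ^ 2)) /
      (2 * q * ∏ j ∈ Finset.Icc 1 k, (q ^ 2 - (2 * (j : ℝ)) ^ 2)) * (4 * (k : ℝ) + 1)) • Φ⁻¹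

/-- The partial denominators `Ã₀ = 0, Ã₁, Ã₂, …` of the simple continued fraction of `ln X`. -/
def logCoeff (Φ : Matrix (Fin m) (Fin m) ℝ) (n : ℕ) : Matrix (Fin m) (Fin m) ℝ :=
  if n = 0 then 0
  else if Even n then
    let k := n / 2
    (2 * (∏ j ∈ Finset.Ico 1 k, (2 * (j : ℝ))) ^ 2 /
      (∏ j ∈ Finset.Icc 1 k, (2 * (j : ℝ) - 1)) ^ 2 * (4 * (k : ℝ) - 1)) • Φ⁻¹
  else
    let k := n / 2
    (-(∏ j ∈ Finset.Icc 1 k, (2 * (j : ℝ) - 1)) ^ 2 /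
      (2 * (∏ j ∈ Finset.Icc 1 k, (2 * (j : ℝ))) ^ 2) * (4 * (k : ℝ) + 1)) • Φ⁻¹

/-- `Pₙ`, the numerators of `[A₀; I / A₁, I / A₂, …]`. -/
def powP (q : ℝ) (Φ : Matrix (Fin m) (Fin m) ℝ) : ℕ → Matrix (Fin m) (Fin m) ℝ :=
  cfNum (powCoeff q Φ) (fun _ => 1)

/-- `Qₙ`, the denominators of `[A₀; I / A₁, I / A₂, …]`. -/
def powQ (q : ℝ) (Φ : Matrix (Fin m) (Fin m) ℝ) : ℕ → Matrix (Fin m) (Fin m) ℝ :=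
  cfDen (powCoeff q Φ) (fun _ => 1)

/-- `P̃ₙ`, the numerators of `[Ã₀; I / Ã₁, I / Ã₂, …]`. -/
def logP (Φ : Matrix (Fin m) (Fin m) ℝ) : ℕ → Matrix (Fin m) (Fin m) ℝ :=
  cfNum (logCoeff Φ) (fun _ => 1)

/-- `Q̃ₙ`, the denominators of `[Ã₀; I / Ã₁, I / Ã₂, …]`. -/
def logQ (Φ : Matrix (Fin m) (Fin m) ℝ) : ℕ → Matrix (Fin m) (Fin m) ℝ :=
  cfDen (logCoeff Φ) (fun _ => 1)

/-- `Gₙ = Qₙ Pₙ₋₁ + Q̃ₙ₋₁ P̃ₙ`, used for `n ≥ 2`. -/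
def matG (q : ℝ) (Φ : Matrix (Fin m) (Fin m) ℝ) (n : ℕ) : Matrix (Fin m) (Fin m) ℝ :=
  powQ q Φ n * powP q Φ (n - 1) + logQ Φ (n - 1) * logP Φ n

/-- `Eₙ = Qₙ Q̃ₙ (Qₙ₋₂ Pₙ₋₁ + Q̃ₙ₋₁ P̃ₙ₋₂)`, used for `n ≥ 2`. -/
def matE (q : ℝ) (Φ : Matrix (Fin m) (Fin m) ℝ) (n : ℕ) : Matrix (Fin m) (Fin m) ℝ :=
  powQ q Φ n * logQ Φ n *
    (powQ q Φ (n - 2) * powP q Φ (n - 1) + logQ Φ (n - 1) * logP Φ (n - 2))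

/-- `Fₙ = Qₙ₋₂ Q̃ₙ₋₂ (Qₙ Pₙ₋₁ + Q̃ₙ₋₁ P̃ₙ)`, used for `n ≥ 2`. -/
def matF (q : ℝ) (Φ : Matrix (Fin m) (Fin m) ℝ) (n : ℕ) : Matrix (Fin m) (Fin m) ℝ :=
  powQ q Φ (n - 2) * logQ Φ (n - 2) * matG q Φ n

/-- The partial numerators of the continued fraction of the entropy (`A` being the first
argument of the entropy, `Φ = φ(A^{-1/2} B A^{-1/2})`); the value at `0` is not used. -/
def entNum (q : ℝ) (A Φ : Matrix (Fin m) (Fin m) ℝ) : ℕ → Matrix (Fin m) (Fin m) ℝ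
  | 0 => 0
  | 1 => (powCoeff q Φ 1 + 1) * matPow A (1 / 2)
  | 2 => ((powCoeff q Φ 1 * powCoeff q Φ 2 + 1) * (powCoeff q Φ 1 + 1)
      + logCoeff Φ 1 * logCoeff Φ 2) * matPow A (-(1 / 2))
  | 3 => (powCoeff q Φ 1 * logCoeff Φ 1)⁻¹ * matE q Φ 2 * matF q Φ 3
  | n + 4 => matE q Φ (n + 3) * matF q Φ (n + 4)

/-- The partial denominators of the continued fraction of the entropy. -/
def entDen (q : ℝ) (A Φ : Matrix (Fin m) (Fin m) ℝ) : ℕ → Matrix (Fin m) (Fin m) ℝ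
  | 0 => 0
  | 1 => powCoeff q Φ 1 * logCoeff Φ 1 * matPow A (-(1 / 2))
  | 2 => (powCoeff q Φ 1 * powCoeff q Φ 2 + powCoeff q Φ 2 + 1) * logCoeff Φ 2
  | n + 3 => matE q Φ (n + 3) - matF q Φ (n + 3)

end

end OperatorEntropy

/-!
In an orthonormal eigenbasis of `X`, every matrix of the theorem except the powers `A ^ (± 1 / 2)` is
diagonal (`eigHom`), so the first two continued fractions are scalar ones, one for each eigenvalue
`x` of `X`. With `t = -(1 - x) / (1 + x)` one has `|t| < 1` and `x = (1 + t) / (1 - t)`.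

*Scalar convergence.* Up to a common nonzero factor (`eq_scaling_mul`), the numerators `N` and
denominators `D` of the convergents solve the recurrence
`sₙ₊₁ = (2n + 1) sₙ + (q² - n²) t² sₙ₋₁` of `legRec`, with `q = 0` for the logarithm. The growth
estimate `legDen_pos_and_growth` shows that the denominators are positive on `|t| < 1` and that
`∏ (k² - q²) ≤ D(q) D(-q)`. The derivatives in `t` obey contiguous relations
(`legRecDeriv_contiguous`), so in the derivative of the error
`log (N / D) - q log ((1 + t) / (1 - t))`, or `N / D - log ((1 + t) / (1 - t))` for the logarithm,
everything cancels except the Casoratian, which is `O(t²ⁿ)` relative to the denominators. The error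
vanishes at `t = 0`, and the mean value inequality shows that it tends to `0`
(`tendsto_legDen_ratio`, `tendsto_legNum_ratio`).

*The entropy.* The products `Cₙ` of the `n`-th convergents of the two continued fractions satisfy
`Cₙ₊₁ - Cₙ = ± Gₙ₊₁ / (Qₙ Q̃ₙ Qₙ₊₁ Q̃ₙ₊₁)` (`prod_convergents_sub`). It follows that they are
themselves the convergents of a continued fraction, with partial numerators `Eₙ₋₁ Fₙ` and
denominators `Eₙ - Fₙ`, whose `n`-th denominator is the product `Eₙ ⋯ E₂` (`prodDen_rec`,
`prodNum_rec`). The first two partial quotients carry the factors `A ^ (± 1 / 2)`, and turn `Cₙ` into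
`A ^ (1 / 2) Cₙ A ^ (1 / 2)` (`entropy_recurrence`). By `crossNum_symm` one has
`Eₙ = Qₙ Q̃ₙ Gₙ₋₁`, and this is invertible: for `n ≥ 3` by the hypothesis on the `Gₙ`, and for
`n = 2` because `G₁` is the numerator `P₁`.
-/

namespace OperatorEntropy

/-! ### The Legendre-type recurrence and its derivative in `t` -/

/-- The solution with initial values `a`, `b` of the recurrence
`sₙ₊₁ = (2n + 1) sₙ + (q² - n²) t² sₙ₋₁`. -/
def legRec (q t a b : ℝ) : ℕ → ℝ
  | 0 => a
  | 1 => b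
  | n + 2 => (2 * n + 3) * legRec q t a b (n + 1) + (q ^ 2 - (n + 1) ^ 2) * t ^ 2 * legRec q t a b n

/-- The derivative in `t` of `legRec q t a b n`, where `a'`, `b'` are the derivatives of the initial
values `a`, `b`. -/
def legRecDeriv (q t a b a' b' : ℝ) : ℕ → ℝ
  | 0 => a'
  | 1 => b'
  | n + 2 => (2 * n + 3) * legRecDeriv q t a b a' b' (n + 1) + (q ^ 2 - (n + 1) ^ 2) *
      (2 * t * legRec q t a b n + t ^ 2 * legRecDeriv q t a b a' b' n)

/-- The common denominators, with `t = -Φ`: those of `((1 + t) / (1 - t)) ^ q` for general `q`, and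
those of `log ((1 + t) / (1 - t))` for `q = 0`. The numerators of the power are
`legDen (-q) t`. Up to factors which depend on `n` and `t` only, these are the values at `1 / t` of
Jacobi polynomials, and of Legendre polynomials for `q = 0`. -/
def legDen (q t : ℝ) : ℕ → ℝ := legRec q t 1 (1 - q * t)

/-- The numerators of `log ((1 + t) / (1 - t))`. -/
def legNum (t : ℝ) : ℕ → ℝ := legRec 0 t 0 (2 * t)

/-- The product `(1² - q²) (2² - q²) ⋯ (n² - q²)`. -/
def sqProd (q : ℝ) (n : ℕ) : ℝ := ∏ k ∈ Finset.range n, (((k : ℝ) + 1) ^ 2 - q ^ 2)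

lemma legRec_add_two (q t a b : ℝ) (n : ℕ) :
    legRec q t a b (n + 2) = (2 * n + 3) * legRec q t a b (n + 1) +
      (q ^ 2 - (n + 1) ^ 2) * t ^ 2 * legRec q t a b n := rfl

lemma legDen_neg (q t : ℝ) : legDen (-q) t = legRec q t 1 (1 - -q * t) := by
  ext k
  induction k using Nat.strongRec with
  | ind k ih =>
    match k with
    | 0 => rfl
    | 1 => rfl
    | k + 2 => rw [legDen, legRec_add_two, ← legDen, legRec_add_two, ih _ (by omega),
        ih _ (by omega), neg_sq]

lemma legRec_casoratian (q t a b c d : ℝ) (n : ℕ) :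
    legRec q t a b (n + 1) * legRec q t c d n - legRec q t a b n * legRec q t c d (n + 1) =
      sqProd q n * t ^ (2 * n) * (b * c - a * d) := by
  induction n with
  | zero => simp [legRec, sqProd]
  | succ n ih =>
    rw [sqProd, Finset.prod_range_succ, ← sqProd, legRec_add_two, legRec_add_two]
    linear_combination (((n : ℝ) + 1) ^ 2 - q ^ 2) * t ^ 2 * ih

lemma hasDerivAt_legRec {q t : ℝ} {a b : ℝ → ℝ} {a' b' : ℝ} (ha : HasDerivAt a a' t)
    (hb : HasDerivAt b b' t) (n : ℕ) :
    HasDerivAt (fun s => legRec q s (a s) (b s) n) (legRecDeriv q t (a t) (b t) a' b' n) t := by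
  induction n using Nat.strongRec with
  | ind n ih =>
    match n with
    | 0 => exact ha
    | 1 => exact hb
    | n + 2 =>
      have h1 := (ih (n + 1) (by omega)).const_mul (2 * (n : ℝ) + 3)
      have h2 := (((hasDerivAt_pow 2 t).const_mul (q ^ 2 - ((n : ℝ) + 1) ^ 2)).fun_mul
        (ih n (by omega)))
      refine (h1.fun_add h2).congr_deriv ?_
      simp only [legRecDeriv]
      push_cast
      ring

/-- The two contiguous relations for the derivative of a solution of the recurrence. They involve a
second solution `g`, which vanishes for the denominators. Each of the two relations is needed in
the inductive step for the other one. -/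
lemma legRecDeriv_contiguous {q t a b a' b' : ℝ} {g : ℕ → ℝ}
    (hg : ∀ n, g (n + 2) = (2 * n + 3) * g (n + 1) + (q ^ 2 - (n + 1) ^ 2) * t ^ 2 * g n)
    (h0 : t * (1 - t ^ 2) * a' = (1 - q * t) * a - b + t * g 0)
    (h1 : (1 - t ^ 2) * b' = -(t + q) * b + (1 - q ^ 2) * t * a + g 1) (n : ℕ) :
    t * (1 - t ^ 2) * legRecDeriv q t a b a' b' n =
        (2 * n + 1 - (n * t + q) * t) * legRec q t a b n - legRec q t a b (n + 1) + t * g n ∧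
      (1 - t ^ 2) * legRecDeriv q t a b a' b' (n + 1) =
        -((n + 1) * t + q) * legRec q t a b (n + 1) +
          ((n + 1) ^ 2 - q ^ 2) * t * legRec q t a b n + g (n + 1) := by
  induction n with
  | zero =>
    simp only [legRec, legRecDeriv, Nat.cast_zero, zero_add]
    constructor
    · linear_combination h0
    · linear_combination h1
  | succ n ih =>
    obtain ⟨ih0, ih1⟩ := ih
    have h2 := legRec_add_two q t a b n
    have h3 : legRecDeriv q t a b a' b' (n + 2) = (2 * n + 3) * legRecDeriv q t a b a' b' (n + 1) +
      (q ^ 2 - (n + 1) ^ 2) *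
      (2 * t * legRec q t a b n + t ^ 2 * legRecDeriv q t a b a' b' n) := rfl
    push_cast
    refine ⟨by rw [h2]; linear_combination t * ih1, ?_⟩
    rw [h3, hg, h2]
    linear_combination (2 * (n : ℝ) + 3) * ih1 + (q ^ 2 - (n + 1) ^ 2) * t * ih0

lemma hasDerivAt_legDen (q t : ℝ) (ht : 1 - t ^ 2 ≠ 0) (n : ℕ) :
    HasDerivAt (fun s => legDen q s (n + 1))
      ((-((n + 1) * t + q) * legDen q t (n + 1) +
        ((n + 1) ^ 2 - q ^ 2) * t * legDen q t n) / (1 - t ^ 2)) t := by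
  have hb : HasDerivAt (fun s : ℝ => 1 - q * s) (-q) t := by
    simpa using ((hasDerivAt_id t).const_mul q).const_sub 1
  refine (hasDerivAt_legRec (q := q) (hasDerivAt_const t (1 : ℝ)) hb (n + 1)).congr_deriv ?_
  rw [eq_div_iff ht, mul_comm]
  have := (legRecDeriv_contiguous (q := q) (t := t) (a := 1) (b := 1 - q * t) (a' := 0) (b' := -q)
    (g := fun _ => 0) (by simp) (by ring) (by ring) n).2
  rw [this, legDen, add_zero]

lemma hasDerivAt_legNum (t : ℝ) (ht : 1 - t ^ 2 ≠ 0) (n : ℕ) :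
    HasDerivAt (fun s => legNum s (n + 1))
      ((-((n + 1) * t) * legNum t (n + 1) + (n + 1) ^ 2 * t * legNum t n + 2 * legDen 0 t (n + 1))
        / (1 - t ^ 2)) t := by
  have hb : HasDerivAt (fun s : ℝ => 2 * s) 2 t := by
    simpa using (hasDerivAt_id t).const_mul 2
  refine (hasDerivAt_legRec (q := 0) (hasDerivAt_const t (0 : ℝ)) hb (n + 1)).congr_deriv ?_
  rw [eq_div_iff ht, mul_comm]
  have := (legRecDeriv_contiguous (q := 0) (t := t) (a := 0) (b := 2 * t) (a' := 0) (b' := 2)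
    (g := fun k => 2 * legDen 0 t k) (by intro n; simp only [legDen, legRec_add_two]; ring)
    (by simp [legDen, legRec]; ring) (by simp [legDen, legRec]; ring) n).2
  rw [this, legNum]
  ring

/-! ### Lower bounds for the denominators -/

lemma legDen_pos_and_growth {q t : ℝ} (hq : |q| < 1) (ht : |t| < 1) (n : ℕ) :
    0 < legDen q t n ∧
      ((2 * n + 1) - n * |t| - q * t) * legDen q t n ≤ legDen q t (n + 1) := by
  have hqt : |q * t| ≤ |t| := by
    rw [abs_mul]; exact mul_le_of_le_one_left (abs_nonneg t) hq.le
  obtain ⟨hqt1, hqt2⟩ := abs_le.1 hqt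
  induction n with
  | zero => simp [legDen, legRec]
  | succ n ih =>
    obtain ⟨hpos, hle⟩ := ih
    have hn : (0 : ℝ) ≤ n := n.cast_nonneg
    have hnt : 0 ≤ n * (1 - |t|) := mul_nonneg hn (by linarith)
    have hnt' : 0 ≤ n * |t| := by positivity
    have hpos' : 0 < legDen q t (n + 1) :=
      lt_of_lt_of_le (mul_pos (by linarith) hpos) hle
    refine ⟨hpos', ?_⟩
    have h2 : legDen q t (n + 2) = (2 * n + 3) * legDen q t (n + 1) +
      (q ^ 2 - (n + 1) ^ 2) * t ^ 2 * legDen q t n := rfl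
    -- `((n + 1)² - q²) t²` is the product of `(n + 1)|t| - qt` and `(n + 1)|t| + qt`,
    -- and the first factor is absorbed by the growth from `n` to `n + 1`.
    have h3 : ((n + 1) * |t| - q * t) * legDen q t n ≤ legDen q t (n + 1) :=
      le_trans (mul_le_mul_of_nonneg_right (by nlinarith) hpos.le) hle
    have h4 := mul_le_mul_of_nonneg_left h3
      (show 0 ≤ (n + 1) * |t| + q * t by nlinarith)
    have h5 : |t| ^ 2 = t ^ 2 := sq_abs t
    rw [h2]
    push_cast
    have h6 : ((n + 1) * |t| + q * t) * (((n + 1) * |t| - q * t) * legDen q t n) =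
        ((n + 1) ^ 2 - q ^ 2) * t ^ 2 * legDen q t n := by
      linear_combination ((n : ℝ) + 1) ^ 2 * legDen q t n * h5
    linarith

lemma legDen_pos {q t : ℝ} (hq : |q| < 1) (ht : |t| < 1) (n : ℕ) : 0 < legDen q t n :=
  (legDen_pos_and_growth hq ht n).1

lemma sqProd_nonneg {q : ℝ} (hq : |q| < 1) (n : ℕ) : 0 ≤ sqProd q n := by
  refine Finset.prod_nonneg fun k _ => ?_
  have := (sq_lt_one_iff_abs_lt_one q).2 hq
  have hk : (0 : ℝ) ≤ k := k.cast_nonneg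
  nlinarith

lemma sqProd_le {q t : ℝ} (hq : |q| < 1) (ht : |t| < 1) (n : ℕ) :
    sqProd q n ≤ legDen q t n * legDen (-q) t n := by
  induction n with
  | zero => simp [sqProd, legDen, legRec]
  | succ n ih =>
    rw [sqProd, Finset.prod_range_succ, ← sqProd]
    have hq' : |(-q)| < 1 := by rwa [abs_neg]
    obtain ⟨p1, g1⟩ := legDen_pos_and_growth hq ht n
    obtain ⟨p2, g2⟩ := legDen_pos_and_growth hq' ht n
    have hqt : |q * t| ≤ |t| := by
      rw [abs_mul]; exact mul_le_of_le_one_left (abs_nonneg t) hq.le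
    have hqt' : |q * t| ≤ |q| := by
      rw [abs_mul]; exact mul_le_of_le_one_right (abs_nonneg q) ht.le
    obtain ⟨hqt1, hqt2⟩ := abs_le.1 hqt
    have hn : (0 : ℝ) ≤ n := n.cast_nonneg
    have hnt : 0 ≤ n * (1 - |t|) := mul_nonneg hn (by linarith)
    have hsq := (sq_lt_one_iff_abs_lt_one q).2 hq
    have hsq' : (q * t) ^ 2 ≤ q ^ 2 := sq_le_sq.2 hqt'
    have hfac : ((n : ℝ) + 1) ^ 2 - q ^ 2 ≤
        ((2 * n + 1) - n * |t| - q * t) * ((2 * n + 1) - n * |t| - -q * t) := by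
      nlinarith
    calc sqProd q n * (((n : ℝ) + 1) ^ 2 - q ^ 2)
        ≤ (legDen q t n * legDen (-q) t n) *
          (((2 * n + 1) - n * |t| - q * t) * ((2 * n + 1) - n * |t| - -q * t)) :=
          mul_le_mul ih hfac (by nlinarith) (mul_pos p1 p2).le
      _ = (((2 * n + 1) - n * |t| - q * t) * legDen q t n) *
          (((2 * n + 1) - n * |t| - -q * t) * legDen (-q) t n) := by ring
      _ ≤ _ := mul_le_mul g1 g2
          (mul_nonneg (by nlinarith) p2.le) (legDen_pos hq ht _).le

/-! ### Convergence of the scalar continued fractions -/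

/-- If `(1 - t²) fₙ'(t)` is bounded by `c t²ⁿ` on `(-1, 1)` and `fₙ(0) = 0`, then `fₙ → 0`
pointwise on `(-1, 1)`. -/
lemma tendsto_zero_of_deriv_bound {f f' : ℕ → ℝ → ℝ} {c : ℝ} (hc : 0 ≤ c)
    (hf : ∀ n t, |t| < 1 → HasDerivAt (f n) (f' n t) t) (hf0 : ∀ n, f n 0 = 0)
    (hb : ∀ n t, |t| < 1 → (1 - t ^ 2) * |f' n t| ≤ c * t ^ (2 * n)) {t : ℝ} (ht : |t| < 1) :
    Tendsto (fun n => f n t) atTop (𝓝 0) := by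
  have ht2 : t ^ 2 < 1 := (sq_lt_one_iff_abs_lt_one t).2 ht
  have key : ∀ n, ‖f n t‖ ≤ c / (1 - t ^ 2) * |t| * (t ^ 2) ^ n := by
    intro n
    have h := Convex.norm_image_sub_le_of_norm_hasDerivWithin_le (f := f n) (f' := f' n)
      (s := Set.Icc (-|t|) |t|) (C := c / (1 - t ^ 2) * (t ^ 2) ^ n) (x := 0) (y := t)
      (fun s hs => (hf n s (lt_of_le_of_lt (abs_le.2 hs) ht)).hasDerivWithinAt)
      (fun s hs => by
        have hs' : |s| ≤ |t| := abs_le.2 hs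
        have h1 := hb n s (lt_of_le_of_lt hs' ht)
        have h2 : s ^ 2 ≤ t ^ 2 := sq_le_sq.2 hs'
        have h3 : s ^ (2 * n) ≤ (t ^ 2) ^ n := by
          rw [pow_mul]; exact pow_le_pow_left₀ (sq_nonneg s) h2 n
        rw [Real.norm_eq_abs, div_mul_eq_mul_div, le_div_iff₀ (by linarith)]
        have h4 := abs_nonneg (f' n s)
        nlinarith [mul_le_mul_of_nonneg_left h3 hc]) (convex_Icc _ _)
      (by simp) (abs_le.1 le_rfl)
    rw [hf0, sub_zero, sub_zero, Real.norm_eq_abs t] at h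
    linarith
  refine squeeze_zero_norm key ?_
  simpa using (tendsto_pow_atTop_nhds_zero_of_lt_one (sq_nonneg t) ht2).const_mul
    (c / (1 - t ^ 2) * |t|)

lemma hasDerivAt_log_div {t : ℝ} (ht : |t| < 1) :
    HasDerivAt (fun s : ℝ => Real.log (1 + s) - Real.log (1 - s)) (2 / (1 - t ^ 2)) t := by
  obtain ⟨h1, h2⟩ := abs_lt.1 ht
  have p1 : (1 + t) ≠ 0 := by linarith
  have p2 : (1 - t) ≠ 0 := by linarith
  have p3 : 1 - t ^ 2 ≠ 0 := by
    rw [show 1 - t ^ 2 = (1 + t) * (1 - t) by ring]; exact mul_ne_zero p1 p2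
  have e1 := ((hasDerivAt_id t).const_add 1).log p1
  have e2 := ((hasDerivAt_id t).const_sub 1).log p2
  refine (e1.fun_sub e2).congr_deriv ?_
  simp only [id_eq]
  field_simp
  ring

lemma legRec_zero_pos (q a b : ℝ) (n : ℕ) :
    legRec q 0 a b (n + 1) = b * ∏ k ∈ Finset.range n, (2 * (k : ℝ) + 3) := by
  induction n with
  | zero => simp [legRec]
  | succ n ih => rw [legRec_add_two, ih, Finset.prod_range_succ]; ring

lemma legDen_zero_right (q : ℝ) (n : ℕ) : legDen q 0 n = legDen (-q) 0 n := by
  cases n with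
  | zero => rfl
  | succ n => simp [legDen, legRec_zero_pos]

/-- The logarithmic error `log (N / D) - q log ((1 + t) / (1 - t))` has a derivative in which, by the
contiguous relations, only the Casoratian of `N` and `D` survives. -/
lemma tendsto_legDen_ratio {q t : ℝ} (hq : |q| < 1) (ht : |t| < 1) :
    Tendsto (fun n => legDen (-q) t n / legDen q t n) atTop (𝓝 (((1 + t) / (1 - t)) ^ q)) := by
  have hq' : |(-q)| < 1 := by rwa [abs_neg]
  have h := tendsto_zero_of_deriv_bound (c := 2 * |q|)
    (f := fun n s => Real.log (legDen (-q) s (n + 1)) - Real.log (legDen q s (n + 1)) -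
      q * (Real.log (1 + s) - Real.log (1 - s)))
    (f' := fun n s => -(2 * q * sqProd q (n + 1) * s ^ (2 * (n + 1))) /
      (legDen q s (n + 1) * legDen (-q) s (n + 1)) / (1 - s ^ 2)) (by positivity)
    (by
      intro n s hs
      have p1 := (legDen_pos hq hs (n + 1)).ne'
      have p2 := (legDen_pos hq' hs (n + 1)).ne'
      have p3 : 1 - s ^ 2 ≠ 0 := (sub_pos.2 ((sq_lt_one_iff_abs_lt_one s).2 hs)).ne'
      have e1 := (hasDerivAt_legDen (-q) s p3 n).log p2
      have e2 := (hasDerivAt_legDen q s p3 n).log p1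
      refine ((e1.fun_sub e2).fun_sub ((hasDerivAt_log_div hs).const_mul q)).congr_deriv ?_
      have hcas := legRec_casoratian q s 1 (1 - -q * s) 1 (1 - q * s) n
      rw [← legDen_neg, ← legDen] at hcas
      rw [sqProd, Finset.prod_range_succ, ← sqProd]
      field_simp
      rw [show 2 * (n + 1) = 2 * n + 2 by ring, pow_add]
      linear_combination (-s * (((n : ℝ) + 1) ^ 2 - q ^ 2)) * hcas)
    (by
      intro n
      simp [legDen_zero_right q (n + 1)])
    (by
      intro n s hs
      have p := mul_pos (legDen_pos hq hs (n + 1)) (legDen_pos hq' hs (n + 1))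
      have p3 : 0 < 1 - s ^ 2 := sub_pos.2 ((sq_lt_one_iff_abs_lt_one s).2 hs)
      have hsq : s ^ 2 ≤ 1 := by linarith
      have h0 := sqProd_nonneg hq (n + 1)
      rw [abs_div, abs_div, abs_neg, abs_of_pos p3, abs_of_pos p, mul_div_cancel₀ _ p3.ne',
        div_le_iff₀ p, abs_mul, abs_mul, abs_mul, abs_of_nonneg h0, abs_two,
        abs_of_nonneg (a := s ^ _) (by rw [pow_mul]; positivity), mul_assoc, mul_assoc (2 * |q|)]
      refine mul_le_mul_of_nonneg_left ?_ (by positivity)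
      rw [mul_comm]
      exact mul_le_mul (by
        rw [pow_mul, pow_mul]; exact pow_le_pow_of_le_one (sq_nonneg s) hsq (by omega))
        (sqProd_le hq hs _) h0 (by rw [pow_mul]; positivity)) ht
  obtain ⟨h1, h2⟩ := abs_lt.1 ht
  have p1 : 0 < 1 + t := by linarith
  have p2 : 0 < 1 - t := by linarith
  have hlim := ((Real.continuous_exp.tendsto _).comp
    (h.add_const (q * (Real.log (1 + t) - Real.log (1 - t)))))
  rw [zero_add] at hlim
  refine (tendsto_add_atTop_iff_nat 1).1 ?_
  rw [Real.rpow_def_of_pos (div_pos p1 p2), Real.log_div p1.ne' p2.ne', mul_comm]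
  refine hlim.congr fun n => ?_
  have d1 := legDen_pos hq ht (n + 1)
  have d2 := legDen_pos hq' ht (n + 1)
  simp only [Function.comp, sub_add_cancel]
  rw [← Real.log_div d2.ne' d1.ne', Real.exp_log (div_pos d2 d1)]

lemma tendsto_legNum_ratio {t : ℝ} (ht : |t| < 1) :
    Tendsto (fun n => legNum t n / legDen 0 t n) atTop (𝓝 (Real.log ((1 + t) / (1 - t)))) := by
  have hq : |(0 : ℝ)| < 1 := by simp
  have h := tendsto_zero_of_deriv_bound (c := 2)
    (f := fun n s => legNum s (n + 1) / legDen 0 s (n + 1) - (Real.log (1 + s) - Real.log (1 - s)))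
    (f' := fun n s => -(2 * sqProd 0 (n + 1) * s ^ (2 * (n + 1))) /
      (legDen 0 s (n + 1) * legDen 0 s (n + 1)) / (1 - s ^ 2)) (by positivity)
    (by
      intro n s hs
      have p1 := (legDen_pos hq hs (n + 1)).ne'
      have p3 : 1 - s ^ 2 ≠ 0 := (sub_pos.2 ((sq_lt_one_iff_abs_lt_one s).2 hs)).ne'
      refine (((hasDerivAt_legNum s p3 n).fun_div (hasDerivAt_legDen 0 s p3 n) p1).fun_sub
        (hasDerivAt_log_div hs)).congr_deriv ?_
      have hcas := legRec_casoratian 0 s 0 (2 * s) 1 (1 - 0 * s) n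
      rw [← legNum, ← legDen] at hcas
      rw [sqProd, Finset.prod_range_succ, ← sqProd]
      field_simp
      rw [show 2 * (n + 1) = 2 * n + 2 by ring, pow_add]
      linear_combination (-s * ((n : ℝ) + 1) ^ 2) * hcas)
    (by
      intro n
      simp [legNum, legRec_zero_pos])
    (by
      intro n s hs
      have p := mul_pos (legDen_pos hq hs (n + 1)) (legDen_pos hq hs (n + 1))
      have p3 : 0 < 1 - s ^ 2 := sub_pos.2 ((sq_lt_one_iff_abs_lt_one s).2 hs)
      have hsq : s ^ 2 ≤ 1 := by linarith
      have h0 := sqProd_nonneg hq (n + 1)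
      rw [abs_div, abs_div, abs_neg, abs_of_pos p3, abs_of_pos p, mul_div_cancel₀ _ p3.ne',
        div_le_iff₀ p, abs_mul, abs_mul, abs_of_nonneg h0, abs_two,
        abs_of_nonneg (a := s ^ _) (by rw [pow_mul]; positivity), mul_assoc, mul_assoc 2]
      refine mul_le_mul_of_nonneg_left ?_ (by positivity)
      rw [mul_comm]
      exact mul_le_mul (by
        rw [pow_mul, pow_mul]; exact pow_le_pow_of_le_one (sq_nonneg s) hsq (by omega))
        (by simpa using sqProd_le hq hs (n + 1)) h0 (by rw [pow_mul]; positivity)) ht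
  obtain ⟨h1, h2⟩ := abs_lt.1 ht
  have p1 : 0 < 1 + t := by linarith
  have p2 : 0 < 1 - t := by linarith
  refine (tendsto_add_atTop_iff_nat 1).1 ?_
  rw [Real.log_div p1.ne' p2.ne']
  simpa using h.add_const (Real.log (1 + t) - Real.log (1 - t))

/-! ### The coefficients as multiples of `Φ⁻¹` -/

/-- The factor of `Φ⁻¹` in the coefficients `powCoeff q Φ n` with `2 ≤ n`; the value at `1` is the
one which fits the same pattern. -/
noncomputable def powConst (q : ℝ) (n : ℕ) : ℝ :=
  if Even n then
    -2 * q * (∏ j ∈ Finset.Ico 1 (n / 2), (q ^ 2 - (2 * (j : ℝ)) ^ 2)) /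
      (∏ j ∈ Finset.Icc 1 (n / 2), (q ^ 2 - (2 * (j : ℝ) - 1) ^ 2)) * (4 * ((n / 2 : ℕ) : ℝ) - 1)
  else
    -(∏ j ∈ Finset.Icc 1 (n / 2), (q ^ 2 - (2 * (j : ℝ) - 1) ^ 2)) /
      (2 * q * ∏ j ∈ Finset.Icc 1 (n / 2), (q ^ 2 - (2 * (j : ℝ)) ^ 2)) *
        (4 * ((n / 2 : ℕ) : ℝ) + 1)

/-- The factor of `Φ⁻¹` in the coefficients `logCoeff Φ n` with `1 ≤ n`. -/
noncomputable def logConst (n : ℕ) : ℝ :=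
  if Even n then
    2 * (∏ j ∈ Finset.Ico 1 (n / 2), (2 * (j : ℝ))) ^ 2 /
      (∏ j ∈ Finset.Icc 1 (n / 2), (2 * (j : ℝ) - 1)) ^ 2 * (4 * ((n / 2 : ℕ) : ℝ) - 1)
  else
    -(∏ j ∈ Finset.Icc 1 (n / 2), (2 * (j : ℝ) - 1)) ^ 2 /
      (2 * (∏ j ∈ Finset.Icc 1 (n / 2), (2 * (j : ℝ))) ^ 2) * (4 * ((n / 2 : ℕ) : ℝ) + 1)

lemma sq_sub_sq_ne_zero {q : ℝ} (hq : |q| < 1) {x : ℝ} (hx : 1 ≤ x) : q ^ 2 - x ^ 2 ≠ 0 := by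
  have := (sq_lt_one_iff_abs_lt_one q).2 hq
  nlinarith

lemma prod_even_ne_zero {q : ℝ} (hq : |q| < 1) (k : ℕ) :
    ∏ j ∈ Finset.Icc 1 k, (q ^ 2 - (2 * (j : ℝ)) ^ 2) ≠ 0 := by
  refine Finset.prod_ne_zero_iff.2 fun j hj => sq_sub_sq_ne_zero hq ?_
  have : (1 : ℝ) ≤ j := by exact_mod_cast (Finset.mem_Icc.1 hj).1
  linarith

lemma prod_odd_ne_zero {q : ℝ} (hq : |q| < 1) (k : ℕ) :
    ∏ j ∈ Finset.Icc 1 k, (q ^ 2 - (2 * (j : ℝ) - 1) ^ 2) ≠ 0 := by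
  refine Finset.prod_ne_zero_iff.2 fun j hj => sq_sub_sq_ne_zero hq ?_
  have : (1 : ℝ) ≤ j := by exact_mod_cast (Finset.mem_Icc.1 hj).1
  linarith

lemma powConst_mul {q : ℝ} (hq : |q| < 1) (hq0 : q ≠ 0) (n : ℕ) :
    powConst q (n + 2) * powConst q (n + 1) * (q ^ 2 - (n + 1) ^ 2) =
      (2 * n + 1) * (2 * n + 3) := by
  obtain ⟨k, rfl | rfl⟩ := Nat.even_or_odd' n
  · have h1 : (2 * k + 1) / 2 = k := by omega
    have h2 : (2 * k + 2) / 2 = k + 1 := by omega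
    have hE := prod_even_ne_zero hq k
    have hO := prod_odd_ne_zero hq k
    have hx := sq_sub_sq_ne_zero hq (x := 2 * (k : ℝ) + 1) (by
      have : (0 : ℝ) ≤ k := k.cast_nonneg
      linarith)
    rw [powConst, powConst, if_pos (by simp [Nat.even_add]), if_neg (by simp), h1, h2,
      Finset.prod_Icc_succ_top (by omega), ← Finset.Ico_add_one_right_eq_Icc 1 k] at *
    push_cast
    rw [show (2 * ((k : ℝ) + 1) - 1) = 2 * k + 1 by ring]
    generalize ∏ j ∈ Finset.Ico 1 (k + 1), (q ^ 2 - (2 * (j : ℝ)) ^ 2) = E at *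
    generalize ∏ j ∈ Finset.Ico 1 (k + 1), (q ^ 2 - (2 * (j : ℝ) - 1) ^ 2) = O at *
    generalize q ^ 2 - (2 * (k : ℝ) + 1) ^ 2 = y at *
    field_simp
    ring
  · have h1 : (2 * k + 1 + 1) / 2 = k + 1 := by omega
    have h2 : (2 * k + 1 + 2) / 2 = k + 1 := by omega
    have hE := prod_even_ne_zero hq k
    have hO := prod_odd_ne_zero hq (k + 1)
    have hx := sq_sub_sq_ne_zero hq (x := 2 * ((k : ℝ) + 1)) (by
      have : (0 : ℝ) ≤ k := k.cast_nonneg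
      linarith)
    rw [powConst, powConst, if_neg (by simp [Nat.even_add]), if_pos (by simp [Nat.even_add]), h1, h2,
      Finset.prod_Icc_succ_top (f := fun j : ℕ => q ^ 2 - (2 * (j : ℝ)) ^ 2) (by omega),
      Finset.Ico_add_one_right_eq_Icc 1 k]
    push_cast
    rw [show (2 * (k : ℝ) + 1 + 1) = 2 * (k + 1) by ring]
    generalize ∏ j ∈ Finset.Icc 1 k, (q ^ 2 - (2 * (j : ℝ)) ^ 2) = E at *
    generalize ∏ j ∈ Finset.Icc 1 (k + 1), (q ^ 2 - (2 * (j : ℝ) - 1) ^ 2) = O at *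
    generalize q ^ 2 - (2 * ((k : ℝ) + 1)) ^ 2 = y at *
    field_simp
    ring

lemma logConst_mul (n : ℕ) :
    logConst (n + 2) * logConst (n + 1) * (0 ^ 2 - (n + 1) ^ 2) = (2 * n + 1) * (2 * n + 3) := by
  have hE : ∀ k : ℕ, ∏ j ∈ Finset.Icc 1 k, (2 * (j : ℝ)) ≠ 0 := fun k =>
    Finset.prod_ne_zero_iff.2 fun j hj => by
      have : (1 : ℝ) ≤ j := by exact_mod_cast (Finset.mem_Icc.1 hj).1
      linarith
  have hO : ∀ k : ℕ, ∏ j ∈ Finset.Icc 1 k, (2 * (j : ℝ) - 1) ≠ 0 := fun k =>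
    Finset.prod_ne_zero_iff.2 fun j hj => by
      have : (1 : ℝ) ≤ j := by exact_mod_cast (Finset.mem_Icc.1 hj).1
      linarith
  obtain ⟨k, rfl | rfl⟩ := Nat.even_or_odd' n
  · have h1 : (2 * k + 1) / 2 = k := by omega
    have h2 : (2 * k + 2) / 2 = k + 1 := by omega
    have hE := hE k
    have hO := hO k
    have hx : 2 * (k : ℝ) + 1 ≠ 0 := by positivity
    rw [logConst, logConst, if_pos (by simp [Nat.even_add]), if_neg (by simp), h1, h2,
      Finset.prod_Icc_succ_top (by omega), ← Finset.Ico_add_one_right_eq_Icc 1 k] at *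
    push_cast
    rw [show (2 * ((k : ℝ) + 1) - 1) = 2 * k + 1 by ring]
    field_simp
    ring
  · have h1 : (2 * k + 1 + 1) / 2 = k + 1 := by omega
    have h2 : (2 * k + 1 + 2) / 2 = k + 1 := by omega
    have hE := hE k
    have hO := hO (k + 1)
    have hx : (k : ℝ) + 1 ≠ 0 := by positivity
    rw [logConst, logConst, if_neg (by simp [Nat.even_add]), if_pos (by simp [Nat.even_add]), h1, h2,
      Finset.prod_Icc_succ_top (f := fun j : ℕ => 2 * (j : ℝ)) (by omega),
      Finset.Ico_add_one_right_eq_Icc 1 k]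
    push_cast
    rw [show (2 * (k : ℝ) + 1 + 1) = 2 * (k + 1) by ring]
    field_simp
    ring

lemma powConst_one (q : ℝ) : powConst q 1 = -1 / (2 * q) := by simp [powConst]

lemma logConst_one : logConst 1 = -1 / 2 := by simp [logConst]

/-! ### Simple continued fractions in a commutative ring -/

section Simple

variable {R : Type*} [CommRing R]

/-- The numerators of the convergents of `[a 0; 1 / a 1, 1 / a 2, …]`. -/
def simpleNum (a : ℕ → R) : ℕ → R
  | 0 => a 0
  | 1 => a 1 * a 0 + 1
  | n + 2 => a (n + 2) * simpleNum a (n + 1) + simpleNum a n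

/-- The denominators of the convergents of `[a 0; 1 / a 1, 1 / a 2, …]`. -/
def simpleDen (a : ℕ → R) : ℕ → R
  | 0 => 1
  | 1 => a 1
  | n + 2 => a (n + 2) * simpleDen a (n + 1) + simpleDen a n

lemma simple_det (a : ℕ → R) (n : ℕ) :
    simpleNum a (n + 1) * simpleDen a n - simpleNum a n * simpleDen a (n + 1) = (-1) ^ n := by
  induction n with
  | zero => simp [simpleNum, simpleDen]; ring
  | succ n ih =>
    simp only [simpleNum, simpleDen, pow_succ]
    linear_combination -ih

variable (a c : ℕ → R)

/-- The numerator of the difference of the products of the `n`-th and `(n + 1)`-st convergents of two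
simple continued fractions, up to sign. In the application this is `Gₙ₊₁`. -/
def crossNum (n : ℕ) : R :=
  simpleDen a (n + 1) * simpleNum a n + simpleDen c n * simpleNum c (n + 1)

lemma crossNum_symm (n : ℕ) :
    crossNum a c n = simpleDen a n * simpleNum a (n + 1) + simpleDen c (n + 1) * simpleNum c n := by
  have h1 := simple_det a n
  have h2 := simple_det c n
  rw [crossNum]
  linear_combination h2 - h1

lemma prod_convergents_sub (n : ℕ) :
    simpleNum a (n + 1) * simpleNum c (n + 1) * (simpleDen a n * simpleDen c n) -
      simpleNum a n * simpleNum c n * (simpleDen a (n + 1) * simpleDen c (n + 1)) =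
      (-1) ^ n * crossNum a c n := by
  have h1 := simple_det a n
  have h2 := simple_det c n
  rw [crossNum]
  linear_combination (simpleNum c (n + 1) * simpleDen c n) * h1 +
    (simpleNum a n * simpleDen a (n + 1)) * h2

/-- The coefficient `Eₙ₊₂`, with its last factor rewritten by `crossNum_symm`. -/
def coeffE (n : ℕ) : R := simpleDen a (n + 2) * simpleDen c (n + 2) * crossNum a c n

/-- The coefficient `Fₙ₊₂`. -/
def coeffF (n : ℕ) : R := simpleDen a n * simpleDen c n * crossNum a c (n + 1)

/-- `prodDen a c n` is the denominator of index `n + 1` of the continued fraction whose convergents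
are the products of the convergents of two simple continued fractions. From index `2` on it is the
product of the `coeffE`. -/
def prodDen : ℕ → R
  | 0 => a 1 * c 1
  | 1 => coeffE a c 0
  | n + 2 => coeffE a c (n + 1) * prodDen (n + 1)

/-- The numerator which goes with `prodDen`. -/
def prodNum : ℕ → R
  | 0 => simpleNum a 1 * simpleNum c 1
  | 1 => simpleNum a 2 * simpleNum c 2 * crossNum a c 0
  | n + 2 => simpleNum a (n + 3) * simpleNum c (n + 3) * crossNum a c (n + 1) * prodDen a c (n + 1)

lemma prodNum_mul (n : ℕ) :
    prodNum a c n * (simpleDen a (n + 1) * simpleDen c (n + 1)) =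
      simpleNum a (n + 1) * simpleNum c (n + 1) * prodDen a c n := by
  match n with
  | 0 => simp [prodNum, prodDen, simpleDen]
  | 1 => simp only [prodNum, prodDen, coeffE]; ring
  | n + 2 => simp only [prodNum, prodDen, coeffE]; ring

/-- Both sides are `± crossNum n * crossNum (n + 1)`. -/
lemma crossNum_mul_sub (n : ℕ) :
    crossNum a c (n + 1) * (simpleNum a n * simpleNum c n * (simpleDen a (n + 1) * simpleDen c (n + 1))
        - simpleNum a (n + 1) * simpleNum c (n + 1) * (simpleDen a n * simpleDen c n)) =
      crossNum a c n * (simpleNum a (n + 2) * simpleNum c (n + 2) *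
        (simpleDen a (n + 1) * simpleDen c (n + 1)) -
        simpleNum a (n + 1) * simpleNum c (n + 1) * (simpleDen a (n + 2) * simpleDen c (n + 2))) := by
  have h1 := prod_convergents_sub a c n
  have h2 := prod_convergents_sub a c (n + 1)
  rw [pow_succ] at h2
  linear_combination -(crossNum a c (n + 1)) * h1 - crossNum a c n * h2

lemma prodDen_rec (n : ℕ) :
    prodDen a c (n + 3) = (coeffE a c (n + 2) - coeffF a c (n + 2)) * prodDen a c (n + 2) +
      coeffE a c (n + 1) * coeffF a c (n + 2) * prodDen a c (n + 1) := by
  simp only [prodDen]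
  ring

lemma prodNum_rec (n : ℕ) :
    prodNum a c (n + 3) = (coeffE a c (n + 2) - coeffF a c (n + 2)) * prodNum a c (n + 2) +
      coeffE a c (n + 1) * coeffF a c (n + 2) * prodNum a c (n + 1) := by
  have h := crossNum_mul_sub a c (n + 2)
  have h1 := prodNum_mul a c (n + 1)
  have e3 : prodNum a c (n + 3) = simpleNum a (n + 4) * simpleNum c (n + 4) * crossNum a c (n + 2) *
      prodDen a c (n + 2) := rfl
  have e2 : prodNum a c (n + 2) = simpleNum a (n + 3) * simpleNum c (n + 3) * crossNum a c (n + 1) *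
      prodDen a c (n + 1) := rfl
  have d2 : prodDen a c (n + 2) = coeffE a c (n + 1) * prodDen a c (n + 1) := rfl
  rw [e3, e2, d2]
  simp only [coeffE, coeffF, Nat.add_assoc, Nat.reduceAdd] at h h1 ⊢
  linear_combination -(crossNum a c (n + 1) * prodDen a c (n + 1)) * h -
    simpleDen a (n + 3) * simpleDen c (n + 3) * crossNum a c (n + 1) * crossNum a c (n + 3) * h1

lemma prodDen_two {u : R} (hu : u * (a 1 * c 1) = 1) :
    prodDen a c 2 = (coeffE a c 1 - coeffF a c 1) * prodDen a c 1 +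
      u * coeffE a c 0 * coeffF a c 1 * prodDen a c 0 := by
  simp only [prodDen]
  linear_combination -coeffE a c 0 * coeffF a c 1 * hu

lemma prodNum_two {u : R} (hu : u * (a 1 * c 1) = 1) :
    prodNum a c 2 = (coeffE a c 1 - coeffF a c 1) * prodNum a c 1 +
      u * coeffE a c 0 * coeffF a c 1 * prodNum a c 0 := by
  have h := crossNum_mul_sub a c 1
  have e1 : simpleDen a 1 = a 1 := rfl
  have e2 : simpleDen c 1 = c 1 := rfl
  simp only [prodNum, prodDen, coeffE, coeffF, Nat.reduceAdd, e1, e2] at h ⊢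
  linear_combination -crossNum a c 0 * h - simpleDen a 2 * simpleDen c 2 * crossNum a c 0 *
    crossNum a c 2 * simpleNum a 1 * simpleNum c 1 * hu

lemma prodDen_one (ha : a 0 = 1) (hc : c 0 = 0) :
    prodDen a c 1 = (a 1 * a 2 + a 2 + 1) * c 2 * prodDen a c 0 +
      ((a 1 * a 2 + 1) * (a 1 + 1) + c 1 * c 2) := by
  simp only [prodDen, coeffE, crossNum, simpleDen, simpleNum, ha, hc]
  ring

lemma prodNum_one (ha : a 0 = 1) (hc : c 0 = 0) :
    prodNum a c 1 = (a 1 * a 2 + a 2 + 1) * c 2 * prodNum a c 0 := by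
  simp only [prodNum, crossNum, simpleDen, simpleNum, ha, hc]
  ring

end Simple

/-! ### Scalar convergents -/

/-- The ratio of the denominators of the simple continued fraction to `legDen`. -/
noncomputable def scaling (c : ℕ → ℝ) (τ : ℝ) (n : ℕ) : ℝ :=
  ∏ k ∈ Finset.range n, c (k + 1) / ((2 * k + 1) * τ)

/-- The relation between consecutive factors which makes `c n / τ` the partial denominators of the
simple continued fraction equivalent to the recurrence of `legRec q`. -/
def IsScaling (q : ℝ) (c : ℕ → ℝ) : Prop :=
  ∀ n : ℕ, c (n + 2) * c (n + 1) * (q ^ 2 - (n + 1) ^ 2) = (2 * n + 1) * (2 * n + 3)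

lemma scaling_ne_zero {q : ℝ} {c : ℕ → ℝ} (hc : IsScaling q c) {τ : ℝ} (hτ : τ ≠ 0) (n : ℕ) :
    scaling c τ n ≠ 0 := by
  refine Finset.prod_ne_zero_iff.2 fun k _ => ?_
  have h := hc k
  have hk : (2 * (k : ℝ) + 1) ≠ 0 := by positivity
  have hk' : (2 * (k : ℝ) + 1) * (2 * k + 3) ≠ 0 := by positivity
  refine div_ne_zero (fun h0 => hk' ?_) (mul_ne_zero hk hτ)
  rw [← h, h0]
  ring

lemma eq_scaling_mul {q : ℝ} {c : ℕ → ℝ} (hc : IsScaling q c) {τ a b : ℝ} (hτ : τ ≠ 0) {w : ℕ → ℝ}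
    (h0 : w 0 = a) (h1 : w 1 = c 1 / τ * b) (h2 : ∀ n, w (n + 2) = c (n + 2) / τ * w (n + 1) + w n)
    (n : ℕ) : w n = scaling c τ n * legRec q (-τ) a b n := by
  induction n using Nat.strongRec with
  | ind n ih =>
    match n with
    | 0 => simp [scaling, legRec, h0]
    | 1 => simp [scaling, legRec, h1]
    | n + 2 =>
      have hn := hc n
      have hk : (2 * (n : ℝ) + 1) ≠ 0 := by positivity
      have hk' : (2 * (n : ℝ) + 3) ≠ 0 := by positivity
      have hs : ∀ k, scaling c τ (k + 1) = scaling c τ k * (c (k + 1) / ((2 * k + 1) * τ)) :=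
        fun k => Finset.prod_range_succ _ _
      rw [h2, ih n (by omega), ih (n + 1) (by omega), legRec_add_two, hs (n + 1), hs n]
      push_cast
      rw [show 2 * ((n : ℝ) + 1) + 1 = 2 * n + 3 by ring, show n + 1 + 1 = n + 2 by ring]
      field_simp
      linear_combination -(scaling c τ n * τ ^ 2 * legRec q (-τ) a b n) * hn

/-- The partial denominators of the simple continued fraction of `((1 - τ) / (1 + τ)) ^ q`. -/
noncomputable def powScalar (q τ : ℝ) (n : ℕ) : ℝ :=
  if n = 0 then 1 else if n = 1 then (-1 - q * τ) / (2 * q * τ) else powConst q n / τ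

/-- The partial denominators of the simple continued fraction of `log ((1 - τ) / (1 + τ))`. -/
noncomputable def logScalar (τ : ℝ) (n : ℕ) : ℝ := if n = 0 then 0 else logConst n / τ

lemma simpleDen_powScalar {q τ : ℝ} (hq : |q| < 1) (hq0 : q ≠ 0) (hτ : τ ≠ 0) (n : ℕ) :
    simpleDen (powScalar q τ) n = scaling (powConst q) τ n * legDen q (-τ) n := by
  refine eq_scaling_mul (powConst_mul hq hq0) hτ rfl ?_ (fun n => rfl) n
  simp [simpleDen, powScalar, powConst_one]
  field_simp
  ring

lemma simpleNum_powScalar {q τ : ℝ} (hq : |q| < 1) (hq0 : q ≠ 0) (hτ : τ ≠ 0) (n : ℕ) :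
    simpleNum (powScalar q τ) n = scaling (powConst q) τ n * legDen (-q) (-τ) n := by
  rw [legDen_neg]
  refine eq_scaling_mul (powConst_mul hq hq0) hτ rfl ?_ (fun n => rfl) n
  simp [simpleNum, powScalar, powConst_one]
  field_simp
  ring

lemma simpleDen_logScalar {τ : ℝ} (hτ : τ ≠ 0) (n : ℕ) :
    simpleDen (logScalar τ) n = scaling logConst τ n * legDen 0 (-τ) n := by
  refine eq_scaling_mul logConst_mul hτ rfl ?_ (fun n => rfl) n
  simp [simpleDen, logScalar]

lemma simpleNum_logScalar {τ : ℝ} (hτ : τ ≠ 0) (n : ℕ) :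
    simpleNum (logScalar τ) n = scaling logConst τ n * legNum (-τ) n := by
  refine eq_scaling_mul logConst_mul hτ rfl ?_ (fun n => rfl) n
  simp [simpleNum, logScalar, logConst_one]
  field_simp

lemma simpleDen_powScalar_ne_zero {q τ : ℝ} (hτ0 : τ ≠ 0) (hτ : |τ| < 1) (hq : |q| < 1)
    (hq0 : q ≠ 0) (n : ℕ) :
    simpleDen (powScalar q τ) n ≠ 0 := by
  rw [simpleDen_powScalar hq hq0 hτ0]
  exact mul_ne_zero (scaling_ne_zero (powConst_mul hq hq0) hτ0 n)
    (legDen_pos hq (by rwa [abs_neg]) n).ne'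

lemma simpleNum_powScalar_ne_zero {q τ : ℝ} (hτ0 : τ ≠ 0) (hτ : |τ| < 1) (hq : |q| < 1)
    (hq0 : q ≠ 0) (n : ℕ) :
    simpleNum (powScalar q τ) n ≠ 0 := by
  rw [simpleNum_powScalar hq hq0 hτ0]
  exact mul_ne_zero (scaling_ne_zero (powConst_mul hq hq0) hτ0 n)
    (legDen_pos (by rwa [abs_neg]) (by rwa [abs_neg]) n).ne'

lemma simpleDen_logScalar_ne_zero {τ : ℝ} (hτ0 : τ ≠ 0) (hτ : |τ| < 1) (n : ℕ) :
    simpleDen (logScalar τ) n ≠ 0 := by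
  rw [simpleDen_logScalar hτ0]
  exact mul_ne_zero (scaling_ne_zero logConst_mul hτ0 n)
    (legDen_pos (by simp) (by rwa [abs_neg]) n).ne'

lemma tendsto_powScalar {q τ : ℝ} (hτ0 : τ ≠ 0) (hτ : |τ| < 1) (hq : |q| < 1)
    (hq0 : q ≠ 0) :
    Tendsto (fun n => simpleNum (powScalar q τ) n / simpleDen (powScalar q τ) n) atTop
      (𝓝 (((1 - τ) / (1 + τ)) ^ q)) := by
  have h := tendsto_legDen_ratio hq (t := -τ) (by rwa [abs_neg])
  rw [sub_neg_eq_add, ← sub_eq_add_neg] at h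
  refine h.congr fun n => ?_
  rw [simpleNum_powScalar hq hq0 hτ0, simpleDen_powScalar hq hq0 hτ0,
    mul_div_mul_left _ _ (scaling_ne_zero (powConst_mul hq hq0) hτ0 n)]

lemma tendsto_logScalar {τ : ℝ} (hτ0 : τ ≠ 0) (hτ : |τ| < 1) :
    Tendsto (fun n => simpleNum (logScalar τ) n / simpleDen (logScalar τ) n) atTop
      (𝓝 (Real.log ((1 - τ) / (1 + τ)))) := by
  have h := tendsto_legNum_ratio (t := -τ) (by rwa [abs_neg])
  rw [sub_neg_eq_add, ← sub_eq_add_neg] at h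
  refine h.congr fun n => ?_
  rw [simpleNum_logScalar hτ0, simpleDen_logScalar hτ0,
    mul_div_mul_left _ _ (scaling_ne_zero logConst_mul hτ0 n)]

variable {m : ℕ}

/-! ### Simultaneous diagonalization -/

/-- The diagonal matrices in an orthonormal eigenbasis of the symmetric matrix `A`, as an
algebra homomorphism from the vectors of diagonal entries. -/
noncomputable def eigHom {A : Matrix (Fin m) (Fin m) ℝ} (hA : A.IsHermitian) :
    (Fin m → ℝ) →ₐ[ℝ] Matrix (Fin m) (Fin m) ℝ :=
  (Unitary.conjStarAlgAut ℝ _ hA.eigenvectorUnitary).toAlgEquiv.toAlgHom.comp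
    (Matrix.diagonalAlgHom ℝ)

section eigHom

variable {A : Matrix (Fin m) (Fin m) ℝ} (hA : A.IsHermitian)

lemma cfc_eq_eigHom (f : ℝ → ℝ) : cfc f A = eigHom hA (fun i => f (hA.eigenvalues i)) := by
  rw [hA.cfc_eq]
  rfl

lemma eigHom_eigenvalues : eigHom hA hA.eigenvalues = A := by
  rw [← cfc_eq_eigHom hA (fun x => x)]
  exact cfc_id' ℝ A

lemma continuous_eigHom : Continuous (eigHom hA) :=
  (eigHom hA).toLinearMap.continuous_of_finiteDimensional

lemma isUnit_eigHom {v : Fin m → ℝ} : IsUnit (eigHom hA v) ↔ ∀ i, v i ≠ 0 := by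
  have h : IsUnit (eigHom hA v) ↔ IsUnit (diagonal v) :=
    MulEquiv.isUnit_map (Unitary.conjStarAlgAut ℝ _ hA.eigenvectorUnitary)
  rw [h, isUnit_iff_isUnit_det, det_diagonal, isUnit_iff_ne_zero, Finset.prod_ne_zero_iff]
  simp

end eigHom

section AlgHom

variable (M : (Fin m → ℝ) →ₐ[ℝ] Matrix (Fin m) (Fin m) ℝ)

lemma inv_algHom {v : Fin m → ℝ} (hv : ∀ i, v i ≠ 0) : (M v)⁻¹ = M v⁻¹ := by
  refine inv_eq_left_inv ?_
  rw [← map_mul, show v⁻¹ * v = 1 from funext fun i => inv_mul_cancel₀ (hv i), map_one]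

lemma cfDen_algHom (a : ℕ → Fin m → ℝ) (n : ℕ) :
    cfDen (fun k => M (a k)) (fun _ => 1) n = M (simpleDen a n) := by
  induction n using Nat.strongRec with
  | ind n ih =>
    match n with
    | 0 => simp [cfDen, simpleDen]
    | 1 => simp [cfDen, simpleDen]
    | n + 2 => simp [cfDen, simpleDen, ih n (by omega), ih (n + 1) (by omega)]

lemma cfNum_algHom (a : ℕ → Fin m → ℝ) (n : ℕ) :
    cfNum (fun k => M (a k)) (fun _ => 1) n = M (simpleNum a n) := by
  induction n using Nat.strongRec with
  | ind n ih =>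
    match n with
    | 0 => simp [cfNum, simpleNum]
    | 1 => simp [cfNum, simpleNum]
    | n + 2 => simp [cfNum, simpleNum, ih n (by omega), ih (n + 1) (by omega)]

/-- The convergents of a simple continued fraction of vectors are computed entry by entry. -/
lemma simpleDen_apply (a : ℕ → Fin m → ℝ) (n : ℕ) (i : Fin m) :
    simpleDen a n i = simpleDen (fun k => a k i) n := by
  induction n using Nat.strongRec with
  | ind n ih =>
    match n with
    | 0 => rfl
    | 1 => rfl
    | n + 2 => simp [simpleDen, ih n (by omega), ih (n + 1) (by omega)]

lemma simpleNum_apply (a : ℕ → Fin m → ℝ) (n : ℕ) (i : Fin m) :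
    simpleNum a n i = simpleNum (fun k => a k i) n := by
  induction n using Nat.strongRec with
  | ind n ih =>
    match n with
    | 0 => rfl
    | 1 => rfl
    | n + 2 => simp [simpleNum, ih n (by omega), ih (n + 1) (by omega)]

lemma isContFrac_algHom (hM : Continuous M) {a : ℕ → Fin m → ℝ} {T : Fin m → ℝ}
    (h0 : ∀ n i, simpleDen (fun k => a k i) n ≠ 0)
    (hlim : ∀ i, Tendsto (fun n => simpleNum (fun k => a k i) n / simpleDen (fun k => a k i) n) atTop
      (𝓝 (T i))) : IsContFrac (fun k => M (a k)) (fun _ => 1) (M T) := by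
  have h0' : ∀ n i, simpleDen a n i ≠ 0 := fun n i => by rw [simpleDen_apply]; exact h0 n i
  refine ⟨fun n => ?_, ?_⟩
  · rw [cfDen_algHom]
    exact (isUnit_iff_exists_inv.2 ⟨(simpleDen a n)⁻¹,
      funext fun i => mul_inv_cancel₀ (h0' n i)⟩).map M
  · have h : Tendsto (fun n => (simpleDen a n)⁻¹ * simpleNum a n) atTop (𝓝 T) := by
      refine tendsto_pi_nhds.2 fun i => (hlim i).congr fun n => ?_
      rw [Pi.mul_apply, Pi.inv_apply, simpleDen_apply, simpleNum_apply, div_eq_inv_mul]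
    refine ((hM.tendsto _).comp h).congr fun n => ?_
    rw [cfDen_algHom, cfNum_algHom, inv_algHom M (h0' n), Function.comp, map_mul]

lemma powCoeff_algHom {q : ℝ} (hq0 : q ≠ 0) {τ : Fin m → ℝ} (hτ : ∀ i, τ i ≠ 0) :
    powCoeff q (M τ) = fun n => M (fun i => powScalar q (τ i) n) := by
  funext n
  by_cases h0 : n = 0
  · subst h0
    simp only [powCoeff, powScalar, if_pos]
    exact (map_one M).symm
  by_cases h1 : n = 1
  · subst h1
    simp only [powCoeff, powScalar, if_pos, one_ne_zero, if_false]
    rw [← map_smul, inv_algHom M (fun i => by simp [hq0, hτ i]), ← map_smul, ← map_one M, ← map_neg,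
      ← map_sub, ← map_mul]
    congr 1
    funext i
    simp [div_eq_inv_mul]
  · have h2 : powCoeff q (M τ) n = powConst q n • (M τ)⁻¹ := by
      simp only [powCoeff, powConst, if_neg h0, if_neg h1]
      split_ifs <;> rfl
    rw [h2, inv_algHom M hτ, ← map_smul]
    simp only [powScalar, if_neg h0, if_neg h1]
    rfl

lemma logCoeff_algHom {τ : Fin m → ℝ} (hτ : ∀ i, τ i ≠ 0) :
    logCoeff (M τ) = fun n => M (fun i => logScalar (τ i) n) := by
  funext n
  by_cases h0 : n = 0
  · subst h0
    simp only [logCoeff, logScalar, if_pos]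
    exact (map_zero M).symm
  · have h2 : logCoeff (M τ) n = logConst n • (M τ)⁻¹ := by
      simp only [logCoeff, logConst, if_neg h0]
      split_ifs <;> rfl
    rw [h2, inv_algHom M hτ, ← map_smul]
    simp only [logScalar, if_neg h0]
    rfl

/-! ### The continued fraction of the entropy -/

section Entropy

variable {q : ℝ} {Φ : Matrix (Fin m) (Fin m) ℝ} {a c : ℕ → Fin m → ℝ}

lemma matG_algHom {M : (Fin m → ℝ) →ₐ[ℝ] Matrix (Fin m) (Fin m) ℝ}
    (ha : powCoeff q Φ = fun n => M (a n)) (hc : logCoeff Φ = fun n => M (c n)) (n : ℕ) :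
    matG q Φ (n + 1) = M (crossNum a c n) := by
  simp only [matG, powQ, powP, logQ, logP, ha, hc, cfDen_algHom, cfNum_algHom, crossNum, map_add,
    map_mul, Nat.add_sub_cancel]

lemma matE_algHom {M : (Fin m → ℝ) →ₐ[ℝ] Matrix (Fin m) (Fin m) ℝ}
    (ha : powCoeff q Φ = fun n => M (a n)) (hc : logCoeff Φ = fun n => M (c n)) (n : ℕ) :
    matE q Φ (n + 2) = M (coeffE a c n) := by
  simp only [matE, powQ, powP, logQ, logP, ha, hc, cfDen_algHom, cfNum_algHom, coeffE,
    crossNum_symm, map_add, map_mul, Nat.add_sub_cancel, show n + 2 - 1 = n + 1 from rfl]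

lemma matF_algHom {M : (Fin m → ℝ) →ₐ[ℝ] Matrix (Fin m) (Fin m) ℝ}
    (ha : powCoeff q Φ = fun n => M (a n)) (hc : logCoeff Φ = fun n => M (c n)) (n : ℕ) :
    matF q Φ (n + 2) = M (coeffF a c n) := by
  rw [matF, matG_algHom ha hc]
  simp only [powQ, logQ, ha, hc, cfDen_algHom, coeffF, map_mul, Nat.add_sub_cancel]

/-- The only matrices outside of the commutative algebra generated by `Φ` are the powers
`A ^ (± 1 / 2)`: in the denominators and numerators they occur as a last factor. -/
lemma entropy_recurrence {M : (Fin m → ℝ) →ₐ[ℝ] Matrix (Fin m) (Fin m) ℝ}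
    (ha : powCoeff q Φ = fun n => M (a n)) (hc : logCoeff Φ = fun n => M (c n))
    (ha0 : a 0 = 1) (hc0 : c 0 = 0) (ha1 : ∀ i, a 1 i ≠ 0) (hc1 : ∀ i, c 1 i ≠ 0)
    (A : Matrix (Fin m) (Fin m) ℝ) (n : ℕ) :
    cfDen (entDen q A Φ) (entNum q A Φ) (n + 1) = M (prodDen a c n) * matPow A (-(1 / 2)) ∧
      cfNum (entDen q A Φ) (entNum q A Φ) (n + 1) = M (prodNum a c n) * matPow A (1 / 2) := by
  have hac : ∀ i, (a 1 * c 1) i ≠ 0 := fun i => mul_ne_zero (ha1 i) (hc1 i)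
  have hu : (a 1 * c 1)⁻¹ * (a 1 * c 1) = 1 := funext fun i => inv_mul_cancel₀ (hac i)
  have ha' : ∀ n, powCoeff q Φ n = M (a n) := fun n => congrFun ha n
  have hc' : ∀ n, logCoeff Φ n = M (c n) := fun n => congrFun hc n
  induction n using Nat.strongRec with
  | ind n ih =>
    match n with
    | 0 =>
      simp [cfDen, cfNum, entDen, entNum, ha', hc', prodDen, prodNum, simpleNum, ha0, hc0]
    | 1 =>
      obtain ⟨i1, i2⟩ := ih 0 (by omega)
      rw [cfDen, cfNum, i1, i2, prodDen_one a c ha0 hc0, prodNum_one a c ha0 hc0]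
      simp only [cfDen, cfNum, entDen, entNum, ha', hc', map_add, map_mul, map_one, mul_one, mul_zero,
        add_zero, add_mul, mul_assoc, and_self]
    | 2 =>
      obtain ⟨i1, i2⟩ := ih 0 (by omega)
      obtain ⟨j1, j2⟩ := ih 1 (by omega)
      rw [cfDen, cfNum, i1, i2, j1, j2, prodDen_two a c hu, prodNum_two a c hu]
      have e : entDen q A Φ 3 = M (coeffE a c 1 - coeffF a c 1) := by
        rw [map_sub, ← matE_algHom ha hc, ← matF_algHom ha hc]; rfl
      have e' : entNum q A Φ 3 = M ((a 1 * c 1)⁻¹ * coeffE a c 0 * coeffF a c 1) := by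
        rw [map_mul, map_mul, ← matE_algHom ha hc, ← matF_algHom ha hc, ← inv_algHom M hac, map_mul,
          ← ha', ← hc']; rfl
      rw [e, e']
      simp only [map_add, map_mul, add_mul, mul_assoc, and_self]
    | n + 3 =>
      obtain ⟨i1, i2⟩ := ih (n + 1) (by omega)
      obtain ⟨j1, j2⟩ := ih (n + 2) (by omega)
      rw [cfDen, cfNum, i1, i2, j1, j2, prodDen_rec, prodNum_rec]
      have e : entDen q A Φ (n + 4) = M (coeffE a c (n + 2) - coeffF a c (n + 2)) := by
        rw [map_sub, ← matE_algHom ha hc, ← matF_algHom ha hc]; rfl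
      have e' : entNum q A Φ (n + 4) = M (coeffE a c (n + 1) * coeffF a c (n + 2)) := by
        rw [map_mul, ← matE_algHom ha hc, ← matF_algHom ha hc]; rfl
      rw [e, e']
      simp only [map_add, map_mul, add_mul, mul_assoc, and_self]

end Entropy

end AlgHom

lemma prodDen_apply_ne_zero {a c : ℕ → Fin m → ℝ} {i : Fin m} (ha : ∀ n, simpleDen a n i ≠ 0)
    (hc : ∀ n, simpleDen c n i ≠ 0) (hG : ∀ n, crossNum a c n i ≠ 0) (n : ℕ) :
    prodDen a c n i ≠ 0 := by
  have hE : ∀ n, coeffE a c n i ≠ 0 := fun n =>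
    mul_ne_zero (mul_ne_zero (ha _) (hc _)) (hG n)
  induction n using Nat.strongRec with
  | ind n ih =>
    match n with
    | 0 => exact mul_ne_zero (ha 1) (hc 1)
    | 1 => exact hE 0
    | n + 2 => exact mul_ne_zero (hE (n + 1)) (ih (n + 1) (by omega))

/-! ### Square roots and the matrix `X` -/

lemma matPow_eq_eigHom {A : Matrix (Fin m) (Fin m) ℝ} (hA : A.IsHermitian) (s : ℝ) :
    matPow A s = eigHom hA (fun i => hA.eigenvalues i ^ s) := cfc_eq_eigHom hA _

lemma matPow_half_mul_neg_half {A : Matrix (Fin m) (Fin m) ℝ} (hA : A.PosDef) :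
    matPow A (1 / 2) * matPow A (-(1 / 2)) = 1 := by
  rw [matPow_eq_eigHom hA.1, matPow_eq_eigHom hA.1, ← map_mul, ← map_one (eigHom hA.1)]
  congr 1
  funext i
  simp [← Real.rpow_add (hA.eigenvalues_pos i)]

lemma matPow_half_mul_self {A : Matrix (Fin m) (Fin m) ℝ} (hA : A.PosDef) :
    matPow A (1 / 2) * matPow A (1 / 2) = A := by
  conv_rhs => rw [← eigHom_eigenvalues hA.1]
  rw [matPow_eq_eigHom hA.1, ← map_mul]
  congr 1
  funext i
  rw [Pi.mul_apply, ← Real.rpow_add (hA.eigenvalues_pos i)]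
  norm_num

lemma relMat_posDef {A B : Matrix (Fin m) (Fin m) ℝ} (hA : A.PosDef) (hB : B.PosDef) :
    (relMat A B).PosDef := by
  have hS : (matPow A (-(1 / 2)))ᴴ = matPow A (-(1 / 2)) :=
    (IsSelfAdjoint.cfc : IsSelfAdjoint (cfc (fun x : ℝ => x ^ (-(1 / 2) : ℝ)) A))
  have hu : IsUnit (matPow A (-(1 / 2))) := by
    rw [matPow_eq_eigHom hA.1, isUnit_eigHom]
    exact fun i => (Real.rpow_pos_of_pos (hA.eigenvalues_pos i) _).ne'
  have h := (Matrix.IsUnit.posDef_star_left_conjugate_iff hu (x := B)).2 hB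
  rwa [star_eq_conjTranspose, hS] at h

end OperatorEntropy

open OperatorEntropy in
theorem theorem3p3 {m : ℕ} (A B : Matrix (Fin m) (Fin m) ℝ) (hA : A.PosDef) (hB : B.PosDef)
    (hAB : IsUnit (A - B)) (q : ℝ) (hq0 : 0 < q) (hq1 : q < 1)
    (X Φ : Matrix (Fin m) (Fin m) ℝ) (hX : X = OperatorEntropy.relMat A B)
    (hΦ : Φ = OperatorEntropy.phi X) :
    Φ = OperatorEntropy.matPow A (1 / 2) * ((A + B)⁻¹ * (A - B)) *
        OperatorEntropy.matPow A (-(1 / 2)) ∧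
    OperatorEntropy.IsContFrac (OperatorEntropy.powCoeff q Φ) (fun _ => 1)
      (OperatorEntropy.matPow X q) ∧
    OperatorEntropy.IsContFrac (OperatorEntropy.logCoeff Φ) (fun _ => 1)
      (OperatorEntropy.matLog X) ∧
    ((∀ n, 2 ≤ n → IsUnit (OperatorEntropy.matG q Φ n)) →
      OperatorEntropy.IsContFrac (OperatorEntropy.entDen q A Φ) (OperatorEntropy.entNum q A Φ)
        (OperatorEntropy.entropy q A B)) := by
  have hq : |q| < 1 := by rwa [abs_of_pos hq0]
  have hXpd : X.PosDef := hX ▸ relMat_posDef hA hB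
  have hTS : matPow A (1 / 2) * matPow A (-(1 / 2)) = 1 := matPow_half_mul_neg_half hA
  have hST : matPow A (-(1 / 2)) * matPow A (1 / 2) = 1 := mul_eq_one_comm.1 hTS
  have hSinv : (matPow A (-(1 / 2)))⁻¹ = matPow A (1 / 2) := inv_eq_left_inv hTS
  have hSunit : IsUnit (matPow A (-(1 / 2))) := ⟨⟨_, _, hST, hTS⟩, rfl⟩
  have hSAS : matPow A (-(1 / 2)) * A * matPow A (-(1 / 2)) = 1 := by
    calc _ = matPow A (-(1 / 2)) * (matPow A (1 / 2) * matPow A (1 / 2)) * matPow A (-(1 / 2)) := by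
          rw [matPow_half_mul_self hA]
      _ = 1 := by rw [← mul_assoc, hST, one_mul, hTS]
  have hsub : 1 - X = matPow A (-(1 / 2)) * (A - B) * matPow A (-(1 / 2)) := by
    rw [mul_sub, sub_mul, hSAS, hX, relMat]
  have hadd : 1 + X = matPow A (-(1 / 2)) * (A + B) * matPow A (-(1 / 2)) := by
    rw [mul_add, add_mul, hSAS, hX, relMat]
  set M := eigHom hXpd.1 with hM
  set x := hXpd.1.eigenvalues with hx
  have hMX : M x = X := eigHom_eigenvalues hXpd.1
  have hxpos : ∀ i, 0 < x i := fun i => hXpd.eigenvalues_pos i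
  have hx1 : ∀ i, 1 - x i ≠ 0 := by
    refine (isUnit_eigHom hXpd.1 (v := fun i => 1 - x i)).1 ?_
    have : M (fun i => 1 - x i) = 1 - X := by
      conv_rhs => rw [← hMX, ← map_one M, ← map_sub]
      rfl
    rw [← hM, this, hsub]
    exact (hSunit.mul hAB).mul hSunit
  have hx2 : ∀ i, 1 + x i ≠ 0 := fun i => by linarith [hxpos i]
  let τ : Fin m → ℝ := fun i => (1 - x i) / (1 + x i)
  have hΦM : Φ = M τ := by
    have h1 : 1 + X = M (fun i => 1 + x i) := by
      conv_lhs => rw [← hMX, ← map_one M, ← map_add]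
      rfl
    have h2 : 1 - X = M (fun i => 1 - x i) := by
      conv_lhs => rw [← hMX, ← map_one M, ← map_sub]
      rfl
    rw [hΦ, phi, h1, h2, inv_algHom M hx2, ← map_mul]
    congr 1
    funext i
    simp [τ, div_eq_inv_mul]
  have hτ0 : ∀ i, τ i ≠ 0 := fun i => div_ne_zero (hx1 i) (hx2 i)
  have hτ1 : ∀ i, |τ i| < 1 := fun i => by
    have := hxpos i
    rw [abs_lt, lt_div_iff₀ (by linarith), div_lt_iff₀ (by linarith)]
    constructor <;> linarith
  have hτx : ∀ i, (1 - τ i) / (1 + τ i) = x i := fun i => by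
    have := hx2 i
    have h3 : 1 + τ i = 2 / (1 + x i) := by simp only [τ]; field_simp; ring
    rw [h3]
    simp only [τ]
    field_simp
    ring
  have ha := powCoeff_algHom M hq0.ne' hτ0
  have hc := logCoeff_algHom M hτ0
  rw [← hΦM] at ha hc
  have hpow : ∀ i, Tendsto (fun n => simpleNum (powScalar q (τ i)) n / simpleDen (powScalar q (τ i)) n)
      atTop (𝓝 (x i ^ q)) := fun i => by
    have := tendsto_powScalar (hτ0 i) (hτ1 i) hq hq0.ne'
    rwa [hτx] at this
  have hlog : ∀ i, Tendsto (fun n => simpleNum (logScalar (τ i)) n / simpleDen (logScalar (τ i)) n)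
      atTop (𝓝 (Real.log (x i))) := fun i => by
    have := tendsto_logScalar (hτ0 i) (hτ1 i)
    rwa [hτx] at this
  have hpow0 := fun n i => simpleDen_powScalar_ne_zero (hτ0 i) (hτ1 i) hq hq0.ne' n
  have hlog0 := fun n i => simpleDen_logScalar_ne_zero (hτ0 i) (hτ1 i) n
  have hXq : matPow X q = M (fun i => x i ^ q) := matPow_eq_eigHom hXpd.1 q
  have hXl : matLog X = M (fun i => Real.log (x i)) := cfc_eq_eigHom hXpd.1 _
  refine ⟨?_, ?_, ?_, fun hG => ?_⟩
  · rw [hΦ, phi, hadd, hsub, Matrix.mul_inv_rev, Matrix.mul_inv_rev, hSinv]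
    simp only [mul_assoc]
    rw [← mul_assoc (matPow A (1 / 2)) (matPow A (-(1 / 2))), hTS, one_mul]
  · rw [ha, hXq]
    exact isContFrac_algHom M (continuous_eigHom hXpd.1) hpow0 hpow
  · rw [hc, hXl]
    exact isContFrac_algHom M (continuous_eigHom hXpd.1) hlog0 hlog
  · set a : ℕ → Fin m → ℝ := fun n i => powScalar q (τ i) n
    set c : ℕ → Fin m → ℝ := fun n i => logScalar (τ i) n
    have hda : ∀ n i, simpleDen a n i ≠ 0 := fun n i => by
      rw [simpleDen_apply]; exact hpow0 n i
    have hdc : ∀ n i, simpleDen c n i ≠ 0 := fun n i => by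
      rw [simpleDen_apply]; exact hlog0 n i
    have ha0 : a 0 = 1 := rfl
    have hc0 : c 0 = 0 := rfl
    have hcross : ∀ n i, crossNum a c n i ≠ 0 := by
      intro n
      match n with
      | 0 =>
        -- The invertibility of `G₁ = A₁ + I` is not among the hypotheses: it is the numerator `P₁`.
        intro i
        have h : crossNum a c 0 = simpleNum a 1 := by
          simp [crossNum, simpleNum, simpleDen, ha0, hc0]
        rw [h, simpleNum_apply]
        exact simpleNum_powScalar_ne_zero (hτ0 i) (hτ1 i) hq hq0.ne' 1
      | n + 1 =>
        rw [← isUnit_eigHom hXpd.1, ← hM, ← matG_algHom ha hc]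
        exact hG _ (by omega)
    have hf : ∀ n i, prodDen a c n i ≠ 0 := fun n i =>
      prodDen_apply_ne_zero (fun n => hda n i) (fun n => hdc n i) (fun n => hcross n i) n
    have hrec := entropy_recurrence ha hc ha0 hc0 (hda 1) (hdc 1) A
    refine ⟨fun n => ?_, ?_⟩
    · cases n with
      | zero => exact isUnit_one
      | succ n =>
        rw [(hrec n).1]
        exact ((isUnit_eigHom hXpd.1).2 (hf n)).mul hSunit
    · refine (tendsto_add_atTop_iff_nat 1).1 ?_
      have hlim : Tendsto (fun n => (prodDen a c n)⁻¹ * prodNum a c n) atTop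
          (𝓝 (fun i => x i ^ q * Real.log (x i))) := by
        refine tendsto_pi_nhds.2 fun i => ?_
        refine (((tendsto_add_atTop_iff_nat 1).2 (hpow i)).mul
          ((tendsto_add_atTop_iff_nat 1).2 (hlog i))).congr fun n => ?_
        have h := congrFun (prodNum_mul a c n) i
        have h1 := hda (n + 1) i
        have h2 := hdc (n + 1) i
        have h3 := hf n i
        simp only [Pi.mul_apply, Pi.inv_apply, simpleDen_apply, simpleNum_apply] at h h1 h2 ⊢
        change simpleNum (fun k => a k i) (n + 1) / simpleDen (fun k => a k i) (n + 1) *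
          (simpleNum (fun k => c k i) (n + 1) / simpleDen (fun k => c k i) (n + 1)) = _
        field_simp
        linear_combination -h
      have hlim' := (((continuous_eigHom hXpd.1).tendsto _).comp hlim).const_mul (matPow A (1 / 2))
        |>.mul_const (matPow A (1 / 2))
      have hT : entropy q A B = matPow A (1 / 2) * M (fun i => x i ^ q * Real.log (x i)) *
          matPow A (1 / 2) := by
        rw [entropy, ← hX, hXq, hXl, mul_assoc (matPow A (1 / 2)), ← map_mul]
        rfl
      rw [hT]
      refine hlim'.congr fun n => ?_
      rw [(hrec n).1, (hrec n).2, Matrix.mul_inv_rev, hSinv, inv_algHom M (hf n), Function.comp, map_mul]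
      simp only [mul_assoc]
      rfl
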